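/- **Conventions.** $\hat f(\boldsymbol\omega)=\int f(\boldsymbol x)e^{-j\boldsymbol\omega^T\boldsymbol x}\,d\boldsymbol x$, extended to $\mathrm L^2$ by Plancherel's theorem; powers of complex numbers are principal powers. For $\theta\in\mathbf R$ let $\boldsymbol u_\theta=(\cos\theta,\sin\theta)$. The directional Hilbert transform $\mathscr H_\theta$ on $\mathrm L^2(\mathbf R^2)$ is the Fourier multiplier operator with $\widehat{\mathscr H_\theta f}(\boldsymbol\omega)=-j\,\mathrm{sign}(\boldsymbol u_\theta^T\boldsymbol\omega)\hat f(\boldsymbol\omega)$, and the fractional directional Hilbert transform is $\mathcal H_{\theta,\bar\tau}=\cos(\pi\bar\tau)\,\mathscr I-\sin(\pi\bar\tau)\,\mathscr H_\theta$ for $\bar\tau\in\mathbf R$. **Splines.** For a degree $\alpha\geq 0$ and a shift $\tau\in\mathbf R$, the fractional B-spline $\beta^\alpha_\tau\in\mathrm L^2(\mathbf R)$ is given by $$\hat\beta^\alpha_\tau(\omega)=\Big(\frac{1-e^{-j\omega}}{j\omega}\Big)^{\frac{\alpha+1}2+\tau}\Big(\frac{1-e^{j\omega}}{-j\omega}\Big)^{\frac{\alpha+1}2-\tau}.$$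 For $|z|=1$ let $H^\alpha_\tau(z)=2^{-(\alpha+1)}(1+z^{-1})^{\frac{\alpha+1}2+\tau}(1+z)^{\frac{\alpha+1}2-\tau}$. Let $Q^\alpha$ be a measurable function on the unit circle, independent of $\tau$, with $Q^\alpha(1)=1$ and such that $|Q^\alpha(z)|\,|1+z|^{\alpha+1}$ is bounded (equivalently, the filters $Q^\alpha H_\tau^\alpha$ are bounded). The spline wavelet $\psi^\alpha_\tau\in\mathrm L^2(\mathbf R)$ of the genus determined by $Q^\alpha$ is the function generated by the wavelet filter $G^\alpha_\tau(z)=z\,Q^\alpha(-z^{-1})\,H^\alpha_\tau(-z^{-1})$, i.e. $2\hat\psi^\alpha_\tau(2\omega)=G^\alpha_\tau(e^{j\omega})\hat\beta^\alpha_\tau(\omega)$. **Dual-tree wavelets.** For a shift vector $\boldsymbol\tau=(\tau_x,\tau_y)\in\mathbf R^2$ and $\boldsymbol x=(x,y)$ put \begin{align*} \psi_1(\boldsymbol x;\alpha,\boldsymbol\tau)&=\psi^\alpha_{\tau_x}(x)\beta^\alpha_{\tau_y}(y), & \psi_2(\boldsymbol x;\alpha,\boldsymbol\tau)&=\psi^\alpha_{\tau_x}(x)\beta^\alpha_{\tau_y+1/2}(y),\\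 \psi_3(\boldsymbol x;\alpha,\boldsymbol\tau)&=\beta^\alpha_{\tau_x}(x)\psi^\alpha_{\tau_y}(y), & \psi_4(\boldsymbol x;\alpha,\boldsymbol\tau)&=\beta^\alpha_{\tau_x+1/2}(x)\psi^\alpha_{\tau_y}(y),\\ \psi_5(\boldsymbol x;\alpha,\boldsymbol\tau)&=\tfrac1{\sqrt2}\big(\psi^\alpha_{\tau_x}(x)\psi^\alpha_{\tau_y}(y)-\psi^\alpha_{\tau_x+1/2}(x)\psi^\alpha_{\tau_y+1/2}(y)\big),\\ \psi_6(\boldsymbol x;\alpha,\boldsymbol\tau)&=\tfrac1{\sqrt2}\big(\psi^\alpha_{\tau_x}(x)\psi^\alpha_{\tau_y}(y)+\psi^\alpha_{\tau_x+1/2}(x)\psi^\alpha_{\tau_y+1/2}(y)\big), \end{align*} with orientations $\theta_1=\theta_2=0$, $\theta_3=\theta_4=\pi/2$, $\theta_5=\pi/4$, $\theta_6=3\pi/4$. **Proposition.** For every $\alpha\ge 0$, every such $Q^\alpha$, every $\ell\in\{1,\dots,6\}$, every $\boldsymbol\tau\in\mathbf R^2$ (in particular $\boldsymbol\tau=(\tau,\tau)$)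 and every $\bar\tau\in\mathbf R$, $$\mathcal H_{\theta_\ell,\bar\tau}\,\psi_\ell(\,\cdot\,;\alpha,\boldsymbol\tau)=\psi_\ell\big(\,\cdot\,;\alpha,\boldsymbol\tau-\bar\tau\mu_\ell\boldsymbol u_{\theta_\ell}\big)\quad\text{in }\mathrm L^2(\mathbf R^2),$$ where $\mu_\ell=1$ for $\ell=1,\dots,4$ and $\mu_\ell=1/\sqrt2$ for $\ell=5,6$. -/

import Mathlib

open scoped NNReal FourierTransform

noncomputable section

namespace DualTreeSpline

open MeasureTheory Complex

/-- The plane `ℝ²`; the coordinates `x 0`, `x 1` are called `x`, `y` below. -/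
abbrev Plane : Type := EuclideanSpace ℝ (Fin 2)

/-- Finite-energy (complex-valued) signals on the line. -/
abbrev L2Line : Type := Lp ℂ 2 (volume : Measure ℝ)

/-- Finite-energy (complex-valued) signals on the plane. -/
abbrev L2Plane : Type := Lp ℂ 2 (volume : Measure Plane)

/-! ### The directional Hilbert transform and its fractional extension -/

/-- The unit vector `u_θ = (cos θ, sin θ)`. -/
def unitVec (θ : ℝ) : Plane := !₂[Real.cos θ, Real.sin θ]

/-- The frequency response `ω ↦ -i sign (u_θ ⬝ ω)` of the directional Hilbert transform.
It is homogeneous of degree zero, so it does not depend on the scaling of the frequency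
variable in the Fourier transform. -/
def dirMultiplier (θ : ℝ) (ω : Plane) : ℂ :=
  -I * ((SignType.sign (inner ℝ (unitVec θ) ω) : ℝ) : ℂ)

theorem memLp_dirMultiplier_mul (θ : ℝ) (f : L2Plane) :
    MemLp (fun ω => dirMultiplier θ ω * f ω) 2 volume := by
  have hm : Measurable (dirMultiplier θ) := by
    have h1 : Measurable fun ω : Plane => inner ℝ (unitVec θ) ω := by fun_prop
    have h2 : Measurable fun t : ℝ => ((SignType.sign t : ℝ)) := by
      have : (fun t : ℝ => ((SignType.sign t : ℝ))) =
          fun t => if 0 < t then 1 else if t < 0 then -1 else 0 := by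
        funext t
        rw [sign_apply]
        split_ifs <;> simp
      rw [this]
      exact Measurable.ite measurableSet_Ioi measurable_const
        (Measurable.ite measurableSet_Iio measurable_const measurable_const)
    exact measurable_const.mul (measurable_ofReal.comp (h2.comp h1))
  refine (Lp.memLp f).of_le (hm.aestronglyMeasurable.mul (Lp.aestronglyMeasurable f))
    (Filter.Eventually.of_forall fun ω => ?_)
  rw [norm_mul]
  refine mul_le_of_le_one_left (norm_nonneg _) ?_
  unfold dirMultiplier
  rcases lt_trichotomy (inner ℝ (unitVec θ) ω) 0 with h | h | h
  · simp [sign_neg h]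
  · simp [h]
  · simp [sign_pos h]

/-- The directional Hilbert transform `H_θ` on `L²(ℝ²)`: the Fourier multiplier operator with
frequency response `-i sign (u_θ ⬝ ω)`. -/
def dirHilbert (θ : ℝ) (f : L2Plane) : L2Plane :=
  𝓕⁻ (memLp_dirMultiplier_mul θ (𝓕 f)).toLp

/-- The fractional directional Hilbert transform
`H_{θ,τ} = cos(πτ) I - sin(πτ) H_θ` on `L²(ℝ²)`. -/
def fdHT (θ τ : ℝ) (f : L2Plane) : L2Plane :=
  (Real.cos (Real.pi * τ) : ℂ) • f - (Real.sin (Real.pi * τ) : ℂ) • dirHilbert θ f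

/-! ### Fractional splines -/

/-- The common modulus of all products of conjugate powers `w ^ a * w' ^ b` with `|w| = |w'|`. -/
theorem norm_cpow_mul_cpow {w w' : ℂ} (h : ‖w'‖ = ‖w‖) {a b s : ℝ} (hs : a + b = s)
    (hs0 : 0 < s) : ‖w ^ (a : ℂ) * w' ^ (b : ℂ)‖ = ‖w‖ ^ s := by
  by_cases hw : w = 0
  · have hw' : w' = 0 := by simpa [hw] using h
    subst hw hw'
    by_cases ha : a = 0
    · have hb : b ≠ 0 := by rintro rfl; simp_all
      simp [Complex.zero_cpow (ofReal_ne_zero.2 hb), Real.zero_rpow hs0.ne']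
    · simp [Complex.zero_cpow (ofReal_ne_zero.2 ha), Real.zero_rpow hs0.ne']
  · have hw' : w' ≠ 0 := by
      rintro rfl
      exact hw (by simpa using h.symm)
    rw [norm_mul, norm_cpow_real, norm_cpow_real, h, ← hs,
      Real.rpow_add (norm_pos_iff.2 hw)]

/-- The Fourier transform (in angular frequency `ω`) of the fractional B-spline `β_τ^α` of
degree `α` and shift `τ`,
`((1 - e^{-iω}) / (iω)) ^ ((α+1)/2 + τ) * ((1 - e^{iω}) / (-iω)) ^ ((α+1)/2 - τ)`,
with principal powers. The value at the single point `ω = 0` is immaterial. -/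
def splineHat (α : ℝ≥0) (τ ω : ℝ) : ℂ :=
  ((1 - exp (-(I * ω))) / (I * ω)) ^ ((((α : ℝ) + 1) / 2 + τ : ℝ) : ℂ) *
    ((1 - exp (I * ω)) / (-(I * ω))) ^ ((((α : ℝ) + 1) / 2 - τ : ℝ) : ℂ)

/-- The refinement filter
`H_τ^α(z) = 2^{-(α+1)} (1 + z⁻¹) ^ ((α+1)/2 + τ) * (1 + z) ^ ((α+1)/2 - τ)` on `|z| = 1`. -/
def refinementFilter (α : ℝ≥0) (τ : ℝ) (z : Circle) : ℂ :=
  (((2 : ℝ) ^ (-((α : ℝ) + 1)) : ℝ) : ℂ) *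
    ((1 + ((z⁻¹ : Circle) : ℂ)) ^ ((((α : ℝ) + 1) / 2 + τ : ℝ) : ℂ) *
      (1 + (z : ℂ)) ^ ((((α : ℝ) + 1) / 2 - τ : ℝ) : ℂ))

/-- The genus of a spline wavelet of degree `α`: a filter `Q^α` (independent of the shift) with
the lowpass constraint `Q^α(1) = 1`, such that the resulting wavelet filters are bounded.
As `|H_τ^α(z)| = 2^{-(α+1)} |1 + z|^{α+1}` for every shift `τ`, the last condition says that
`Q^α H_τ^α` is bounded; it holds in particular when `Q^α` is bounded. Complex filter coefficients
are allowed; for real ones (`Q^α(z⁻¹)` the conjugate of `Q^α(z)`) the wavelets are real-valued. -/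
structure Genus (α : ℝ≥0) where
  /-- the transfer function `Q^α` on the unit circle -/
  Q : Circle → ℂ
  measurable_Q : @Measurable Circle ℂ (borel Circle) _ Q
  lowpass : Q 1 = 1
  bounded : ∃ C : ℝ, ∀ z : Circle, ‖Q z‖ * ‖1 + (z : ℂ)‖ ^ ((α : ℝ) + 1) ≤ C

/-- The wavelet filter `G_τ^α(z) = z Q^α(-z⁻¹) H_τ^α(-z⁻¹)`. -/
def waveletFilter {α : ℝ≥0} (q : Genus α) (τ : ℝ) (z : Circle) : ℂ :=
  z * q.Q (-z⁻¹) * refinementFilter α τ (-z⁻¹)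

/-- The Fourier transform (in angular frequency) of the spline wavelet `ψ_τ^α` generated by the
wavelet filter, `ψ_τ^α(x/2) = ∑ₖ g_τ^α[k] β_τ^α(x - k)`; that is,
`2 ψ̂_τ^α(2ω) = G_τ^α(e^{iω}) β̂_τ^α(ω)`. -/
def waveletHat {α : ℝ≥0} (q : Genus α) (τ ω : ℝ) : ℂ :=
  (1 / 2) * waveletFilter q τ (Circle.exp (ω / 2)) * splineHat α τ (ω / 2)

theorem norm_splineHat (α : ℝ≥0) (τ ω : ℝ) :
    ‖splineHat α τ ω‖ = ‖(1 - exp (I * ω)) / (I * ω)‖ ^ ((α : ℝ) + 1) := by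
  have key : ‖1 - exp (-(I * (ω : ℂ)))‖ = ‖1 - exp (I * (ω : ℂ))‖ := by
    have h : (starRingEnd ℂ) (1 - exp (I * (ω : ℂ))) = 1 - exp (-(I * (ω : ℂ))) := by
      rw [map_sub, map_one, ← exp_conj]
      simp
    rw [← h, norm_conj]
  unfold splineHat
  rw [norm_cpow_mul_cpow (s := (α : ℝ) + 1) _ (by ring) (by positivity), norm_div, norm_div, key]
  rw [norm_div, norm_div, key, norm_neg]

theorem norm_splineHat_sq_le (α : ℝ≥0) (τ ω : ℝ) :
    ‖splineHat α τ ω‖ ^ 2 ≤ 5 * (1 + ω ^ 2)⁻¹ := by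
  set r : ℝ := ‖(1 - exp (I * ω)) / (I * ω)‖ with hr
  have hr0 : 0 ≤ r := norm_nonneg _
  have hnum1 : ‖1 - exp (I * (ω : ℂ))‖ ≤ |ω| := by
    rw [norm_sub_rev]
    exact Real.norm_exp_I_mul_ofReal_sub_one_le
  have hnum2 : ‖1 - exp (I * (ω : ℂ))‖ ≤ 2 := by
    refine (norm_sub_le _ _).trans ?_
    rw [mul_comm, norm_exp_ofReal_mul_I]
    norm_num
  have hreq : r = ‖1 - exp (I * (ω : ℂ))‖ / |ω| := by
    rw [hr, norm_div]
    simp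
  have hr1 : r ≤ 1 := by
    rw [hreq]
    exact div_le_one_of_le₀ hnum1 (abs_nonneg _)
  have hrω : r * |ω| ≤ 2 := by
    rw [hreq]
    rcases eq_or_ne ω 0 with h | h
    · simp [h]
    · rwa [div_mul_cancel₀ _ (abs_pos.2 h).ne']
  have hle : ‖splineHat α τ ω‖ ≤ r := by
    rw [norm_splineHat]
    calc r ^ ((α : ℝ) + 1) ≤ r ^ (1 : ℝ) := by
          rcases hr0.eq_or_lt with h | h
          · rw [← h, Real.zero_rpow (by positivity), Real.zero_rpow one_ne_zero]
          · exact Real.rpow_le_rpow_of_exponent_ge h hr1 (by simp)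
      _ = r := Real.rpow_one r
  rw [← div_eq_mul_inv, le_div_iff₀ (by positivity)]
  have h2 : (r * |ω|) ^ 2 ≤ 2 ^ 2 := pow_le_pow_left₀ (by positivity) hrω 2
  rw [mul_pow, sq_abs] at h2
  have h3 : ‖splineHat α τ ω‖ ^ 2 ≤ r ^ 2 := pow_le_pow_left₀ (norm_nonneg _) hle 2
  have h4 : r ^ 2 ≤ 1 := pow_le_one₀ hr0 hr1
  nlinarith [sq_nonneg ω]

theorem measurable_splineHat (α : ℝ≥0) (τ : ℝ) : Measurable (splineHat α τ) := by
  unfold splineHat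
  fun_prop

theorem memLp_splineHat_comp (α : ℝ≥0) (τ : ℝ) {c : ℝ} (hc : c ≠ 0) :
    MemLp (fun ξ => splineHat α τ (c * ξ)) 2 volume := by
  have hm : Measurable fun ξ => splineHat α τ (c * ξ) :=
    (measurable_splineHat α τ).comp (measurable_const_mul c)
  rw [memLp_two_iff_integrable_sq_norm hm.aestronglyMeasurable]
  have hi : Integrable fun ξ : ℝ => 5 * (1 + (c * ξ) ^ 2)⁻¹ :=
    (integrable_inv_one_add_sq.comp_mul_left' hc).const_mul 5
  refine hi.mono' (hm.norm.pow_const 2).aestronglyMeasurable (Filter.Eventually.of_forall fun ξ => ?_)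
  rw [Real.norm_of_nonneg (by positivity)]
  exact norm_splineHat_sq_le α τ (c * ξ)

theorem norm_refinementFilter (α : ℝ≥0) (τ : ℝ) (z : Circle) :
    ‖refinementFilter α τ z‖ = (2 : ℝ) ^ (-((α : ℝ) + 1)) * ‖1 + (z : ℂ)‖ ^ ((α : ℝ) + 1) := by
  have key : ‖1 + ((z⁻¹ : Circle) : ℂ)‖ = ‖1 + (z : ℂ)‖ := by
    rw [Circle.coe_inv_eq_conj, ← norm_conj]
    simp
  unfold refinementFilter
  rw [norm_mul, norm_cpow_mul_cpow (s := (α : ℝ) + 1) key.symm (by ring) (by positivity), key,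
    norm_real, Real.norm_of_nonneg (by positivity)]

theorem measurable_waveletHat {α : ℝ≥0} (q : Genus α) (τ : ℝ) :
    Measurable (waveletHat q τ) := by
  borelize Circle
  have h0 : Measurable fun ω : ℝ => Circle.exp (ω / 2) :=
    (Circle.exp.continuous.comp (continuous_id.div_const 2)).measurable
  have h1 : Measurable fun ω : ℝ => -(Circle.exp (ω / 2))⁻¹ :=
    ((Circle.exp.continuous.comp (continuous_id.div_const 2)).inv.neg).measurable
  have hcc : Continuous fun z : Circle => (z : ℂ) := by fun_prop
  have hc : Measurable fun z : Circle => (z : ℂ) := hcc.measurable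
  have hQ : Measurable fun ω : ℝ => q.Q (-(Circle.exp (ω / 2))⁻¹) := q.measurable_Q.comp h1
  have hR : Measurable (refinementFilter α τ) := by
    have hci : Measurable fun z : Circle => ((z⁻¹ : Circle) : ℂ) :=
      (hcc.comp continuous_inv).measurable
    unfold refinementFilter
    fun_prop
  unfold waveletHat waveletFilter
  exact (measurable_const.mul (((hc.comp h0).mul hQ).mul (hR.comp h1))).mul
    ((measurable_splineHat α τ).comp (measurable_id.div_const 2))

theorem memLp_waveletHat_comp {α : ℝ≥0} (q : Genus α) (τ : ℝ) {c : ℝ} (hc : c ≠ 0) :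
    MemLp (fun ξ => waveletHat q τ (c * ξ)) 2 volume := by
  obtain ⟨C, hC⟩ := q.bounded
  have h2 : c / 2 ≠ 0 := div_ne_zero hc two_ne_zero
  refine (memLp_splineHat_comp α τ h2).of_le_mul
    (c := 1 / 2 * ((2 : ℝ) ^ (-((α : ℝ) + 1)) * C))
    ((measurable_waveletHat q τ).comp (measurable_const_mul c)).aestronglyMeasurable
    (Filter.Eventually.of_forall fun ξ => ?_)
  unfold waveletHat waveletFilter
  rw [show c * ξ / 2 = c / 2 * ξ by ring, norm_mul, norm_mul, norm_mul, norm_mul,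
    norm_refinementFilter, Circle.norm_coe]
  refine mul_le_mul_of_nonneg_right ?_ (norm_nonneg _)
  have h := hC (-(Circle.exp (c / 2 * ξ))⁻¹)
  have hp : (0 : ℝ) ≤ (2 : ℝ) ^ (-((α : ℝ) + 1)) := by positivity
  have := mul_le_mul_of_nonneg_left h hp
  rw [show ‖(1 / 2 : ℂ)‖ = 1 / 2 by norm_num]
  nlinarith

/-- The fractional B-spline `β_τ^α ∈ L²(ℝ)`. Mathlib's Fourier transform uses the frequency
variable `ξ = ω / (2π)`. -/
def spline (α : ℝ≥0) (τ : ℝ) : L2Line :=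
  𝓕⁻ (memLp_splineHat_comp α τ (c := 2 * Real.pi) Real.two_pi_pos.ne').toLp

/-- The spline wavelet `ψ_τ^α ∈ L²(ℝ)` of the given genus. -/
def wavelet {α : ℝ≥0} (q : Genus α) (τ : ℝ) : L2Line :=
  𝓕⁻ (memLp_waveletHat_comp q τ (c := 2 * Real.pi) Real.two_pi_pos.ne').toLp

/-! ### Tensor products and the six dual-tree wavelets -/

theorem memLp_tensor (f g : L2Line) :
    MemLp (fun x : Plane => f (x 0) * g (x 1)) 2 volume := by
  have hmp : MeasurePreserving (fun x : Plane => (x 0, x 1))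
      (volume : Measure Plane) ((volume : Measure ℝ).prod (volume : Measure ℝ)) :=
    (volume_preserving_finTwoArrow ℝ).comp (PiLp.volume_preserving_ofLp (Fin 2))
  have hprod : MemLp (fun p : ℝ × ℝ => f p.1 * g p.2) 2
      ((volume : Measure ℝ).prod (volume : Measure ℝ)) := by
    have hm : AEStronglyMeasurable (fun p : ℝ × ℝ => f p.1 * g p.2)
        ((volume : Measure ℝ).prod (volume : Measure ℝ)) :=
      (Lp.aestronglyMeasurable f).comp_fst.mul (Lp.aestronglyMeasurable g).comp_snd
    rw [memLp_two_iff_integrable_sq_norm hm]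
    have hf := (memLp_two_iff_integrable_sq_norm (Lp.aestronglyMeasurable f)).1 (Lp.memLp f)
    have hg := (memLp_two_iff_integrable_sq_norm (Lp.aestronglyMeasurable g)).1 (Lp.memLp g)
    simpa [mul_pow] using hf.mul_prod hg
  exact hprod.comp_measurePreserving hmp

/-- The tensor product `(x, y) ↦ f(x) g(y)`, as an element of `L²(ℝ²)`. -/
def tensor (f g : L2Line) : L2Plane := (memLp_tensor f g).toLp

/-- The six (real-part) dual-tree wavelets `ψ_ℓ(x; α, τ)`, `ℓ = 1, …, 6` (indexed here by
`0, …, 5`), with shift vector `τ = (τ_x, τ_y)`. They are built from the spline scaling function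
`β_t` and wavelet `ψ_t`, and from the scaling function `β_{t+1/2}` and wavelet `ψ_{t+1/2}` of the
second branch (`ψ_{t+1/2}` is the Hilbert transform of `ψ_t`). -/
def dualTreeWavelet {α : ℝ≥0} (q : Genus α) (l : Fin 6) (τ : Plane) : L2Plane :=
  ![tensor (wavelet q (τ 0)) (spline α (τ 1)),
    tensor (wavelet q (τ 0)) (spline α (τ 1 + 1 / 2)),
    tensor (spline α (τ 0)) (wavelet q (τ 1)),
    tensor (spline α (τ 0 + 1 / 2)) (wavelet q (τ 1)),
    ((1 / Real.sqrt 2 : ℝ) : ℂ) • (tensor (wavelet q (τ 0)) (wavelet q (τ 1)) -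
      tensor (wavelet q (τ 0 + 1 / 2)) (wavelet q (τ 1 + 1 / 2))),
    ((1 / Real.sqrt 2 : ℝ) : ℂ) • (tensor (wavelet q (τ 0)) (wavelet q (τ 1)) +
      tensor (wavelet q (τ 0 + 1 / 2)) (wavelet q (τ 1 + 1 / 2)))] l

/-- The orientations `θ_1 = θ_2 = 0`, `θ_3 = θ_4 = π/2`, `θ_5 = π/4`, `θ_6 = 3π/4`. -/
def orientation (l : Fin 6) : ℝ :=
  ![0, 0, Real.pi / 2, Real.pi / 2, Real.pi / 4, 3 * Real.pi / 4] l

/-- `μ_ℓ = 1` for `ℓ = 1, …, 4` and `μ_ℓ = 1/√2` for `ℓ = 5, 6`. -/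
def shiftFactor (l : Fin 6) : ℝ :=
  ![1, 1, 1, 1, 1 / Real.sqrt 2, 1 / Real.sqrt 2] l

end DualTreeSpline

end

namespace DualTreeSpline

open MeasureTheory Complex SchwartzMap

/-! ### The phase of the wavelet filter and of the spline -/

/-! Everything is compared on the Fourier side. There a change of shift moves weight between two
conjugate powers, so it only rotates the phase. For `ψ_t` two rotations combine: the filter
contributes `2t` times the argument of `1 - e^{iν}`, and the spline contributes `2t` times the
argument of `(1 - e^{-iν})/(iν)`, with `ν = ω/2`. The numerators have opposite arguments, so only
the argument of `1/(iν)` survives, namely `∓π/2`. Shifting `ψ` by `t` therefore multiplies its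
transform by `e^{-iπt sign ω}` (`waveletHat_eq_mul_phase`).

The multiplier of the fractional transform is `e^{iπt sign(u_θ ⬝ ω)}` off the line `u_θ ⬝ ω = 0`.
Since transforms of tensor products factor (`fourier_tensor`), this settles `ψ_1` to `ψ_4`, where
`u_θ ⬝ ω` is the frequency coordinate of the wavelet factor. For `ψ_5` and `ψ_6` the two branches
cancel on two opposite quadrants. On the other two, `sign(u_θ ⬝ ω)` is constant, and the half-shifts
of the two coordinates add up to `t` (`fdHTMultiplier_mul_dualTreeHat`). -/

/-- Shifting a product of conjugate powers multiplies it by a phase. -/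
theorem cpow_mul_conj_cpow {w : ℂ} (hw : w ≠ 0) (harg : w.arg ≠ Real.pi) (a t : ℝ) :
    w ^ ((a + t : ℝ) : ℂ) * (starRingEnd ℂ w) ^ ((a - t : ℝ) : ℂ) =
      w ^ ((a + 0 : ℝ) : ℂ) * (starRingEnd ℂ w) ^ ((a - 0 : ℝ) : ℂ) *
        exp (2 * I * t * w.arg) := by
  have hc : starRingEnd ℂ w ≠ 0 := by simpa using hw
  -- Off the branch cut, `log` commutes with conjugation; the `t`-dependent part of the exponent is
  -- then `2it arg w`.
  have hlog : log (starRingEnd ℂ w) = log w - 2 * I * w.arg := by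
    rw [log_conj w harg]
    apply Complex.ext <;> simp [log_re, log_im]
    ring
  simp only [cpow_def_of_ne_zero hw, cpow_def_of_ne_zero hc, hlog, ← exp_add]
  congr 1
  push_cast
  ring

theorem one_sub_exp_conj (ν : ℝ) :
    starRingEnd ℂ (1 - exp (I * ν)) = 1 - exp (-(I * ν)) := by
  rw [map_sub, map_one, ← exp_conj]
  simp

/-- The real part of `1 - e^{iν}` is positive when `ν` is not a multiple of `2π`. -/
theorem one_sub_exp_re_pos {ν : ℝ} (hν : exp (I * ν) ≠ 1) : 0 < (1 - exp (I * (ν : ℂ))).re := by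
  have hre : (exp (I * (ν : ℂ))).re = Real.cos ν := by
    rw [mul_comm, exp_ofReal_mul_I_re]
  have him : (exp (I * (ν : ℂ))).im = Real.sin ν := by
    rw [mul_comm, exp_ofReal_mul_I_im]
  rw [sub_re, one_re, hre, sub_pos]
  refine lt_of_le_of_ne (Real.cos_le_one ν) fun h => hν ?_
  apply Complex.ext
  · rw [hre, h, one_re]
  · have := Real.sin_sq_add_cos_sq ν
    rw [h] at this
    rw [him, one_im]
    nlinarith

/-- The only source of the sign in the wavelet phase: `1/(iν)` is a positive multiple of `-i` or of
`i`. -/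
theorem arg_neg_I_div {ν : ℝ} (hν : ν ≠ 0) :
    (I * (ν : ℂ))⁻¹.arg = -(Real.pi / 2) * (SignType.sign ν : ℝ) := by
  have h : (I * (ν : ℂ))⁻¹ = ((ν⁻¹ : ℝ) : ℂ) * (-I) := by
    rw [mul_inv, inv_I]
    push_cast
    ring
  rw [h]
  rcases hν.lt_or_gt with h0 | h0
  · have : ((ν⁻¹ : ℝ) : ℂ) * (-I) = ((-ν⁻¹ : ℝ) : ℂ) * I := by push_cast; ring
    rw [this, arg_real_mul _ (by simpa using h0), arg_I, sign_neg h0]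
    simp
  · rw [arg_real_mul _ (by simpa using h0), arg_neg_I, sign_pos h0]
    simp

/-- The phases of `1 - e^{iν}` and of `(1 - e^{-iν}) / (iν)` add up to `-(π/2) sign ν`. -/
theorem arg_one_sub_exp_add {ν : ℝ} (hν : exp (I * ν) ≠ 1) :
    (1 - exp (I * (ν : ℂ))).arg + ((1 - exp (-(I * (ν : ℂ)))) / (I * ν)).arg =
        -(Real.pi / 2) * (SignType.sign ν : ℝ) ∧
      ((1 - exp (-(I * (ν : ℂ)))) / (I * ν)).arg ≠ Real.pi := by
  have hν0 : ν ≠ 0 := by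
    rintro rfl
    simp at hν
  have hre := one_sub_exp_re_pos hν
  have hA := abs_lt.1 (abs_arg_lt_pi_div_two_iff.2 (Or.inl hre))
  set u := 1 - exp (I * (ν : ℂ)) with hu
  have hconj : (starRingEnd ℂ u).arg = -u.arg := by
    rw [arg_conj, if_neg]
    linarith [Real.pi_pos]
  have hu0 : u ≠ 0 := fun h => by simp [h] at hre
  have hinv := arg_neg_I_div hν0
  have hs : |(Real.pi / 2) * (SignType.sign ν : ℝ)| ≤ Real.pi / 2 := by
    rw [abs_mul, abs_of_pos Real.pi_div_two_pos]
    rcases hν0.lt_or_gt with h0 | h0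
    · simp [sign_neg h0]
    · simp [sign_pos h0]
  have hs' := abs_le.1 hs
  -- An angle strictly inside `(-π/2, π/2)` plus `±π/2` stays strictly inside `(-π, π)`, so
  -- principal arguments add without wrapping and `π` is not attained.
  have hmul : ((1 - exp (-(I * (ν : ℂ)))) / (I * ν)).arg =
      -u.arg + -(Real.pi / 2) * (SignType.sign ν : ℝ) := by
    rw [← one_sub_exp_conj, ← hu, div_eq_mul_inv, ← hconj, ← hinv]
    refine arg_mul (by simpa using hu0) (by simp [hν0]) ?_
    rw [hconj, hinv]
    constructor <;> linarith
  rw [hmul]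
  exact ⟨by ring, by linarith⟩

theorem splineHat_eq_mul_exp (α : ℝ≥0) (t : ℝ) {ν : ℝ} (hν : exp (I * ν) ≠ 1) :
    splineHat α t ν = splineHat α 0 ν *
      exp (2 * I * t * ((1 - exp (-(I * (ν : ℂ)))) / (I * ν)).arg) := by
  have hconj : (1 - exp (I * (ν : ℂ))) / (-(I * ν)) =
      starRingEnd ℂ ((1 - exp (-(I * (ν : ℂ)))) / (I * ν)) := by
    rw [← one_sub_exp_conj, map_div₀, conj_conj]
    simp
  unfold splineHat
  rw [hconj]
  -- The exponents `a + 0` and `a - 0` in that lemma are what `splineHat α 0` unfolds to.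
  refine cpow_mul_conj_cpow ?_ (arg_one_sub_exp_add hν).2 _ _
  refine div_ne_zero ?_ (mul_ne_zero I_ne_zero ?_)
  · rw [← one_sub_exp_conj]
    exact (map_ne_zero _).2 (sub_ne_zero.2 hν.symm)
  · rintro h
    simp [h] at hν

/-- At `-z⁻¹` the base carrying the exponent `+t` is `1 - e^{iν}`, the conjugate of the numerator of
the spline's corresponding base; hence the later cancellation. -/
theorem refinementFilter_eq_mul_exp (α : ℝ≥0) (t : ℝ) {ν : ℝ} (hν : exp (I * ν) ≠ 1) :
    refinementFilter α t (-(Circle.exp ν)⁻¹) = refinementFilter α 0 (-(Circle.exp ν)⁻¹) *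
      exp (2 * I * t * (1 - exp (I * (ν : ℂ))).arg) := by
  have h1 : (1 + (((-(Circle.exp ν)⁻¹)⁻¹ : Circle) : ℂ)) = 1 - exp (I * ν) := by
    rw [inv_neg, inv_inv, Circle.coe_neg, Circle.coe_exp, mul_comm, sub_eq_add_neg]
  have h2 : (1 + ((-(Circle.exp ν)⁻¹ : Circle) : ℂ)) = starRingEnd ℂ (1 - exp (I * ν)) := by
    rw [one_sub_exp_conj, Circle.coe_neg, Circle.coe_inv, Circle.coe_exp, ← exp_neg, mul_comm,
      sub_eq_add_neg]
  have hre := one_sub_exp_re_pos hν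
  have hA := abs_lt.1 (abs_arg_lt_pi_div_two_iff.2 (Or.inl hre))
  unfold refinementFilter
  rw [h1, h2, mul_assoc, ← cpow_mul_conj_cpow]
  · intro h
    simp [h] at hre
  · linarith [Real.pi_pos]

/-- The phase factor `e^{-iπt}`. -/
noncomputable def phase (t : ℝ) : ℂ := exp (-(Real.pi * t * I))

theorem phase_add (s t : ℝ) : phase (s + t) = phase s * phase t := by
  simp only [phase, ← exp_add]
  congr 1
  push_cast
  ring

theorem phase_one : phase 1 = -1 := by simp [phase, exp_neg]

/-- Off the zeros of the wavelet filter, a shift of the wavelet by `t` multiplies its Fourier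
transform by `e^{-iπ t sign ω}`. -/
theorem waveletHat_eq_mul_phase {α : ℝ≥0} (q : Genus α) (t : ℝ) {ω : ℝ}
    (hω : exp (I * (ω / 2 : ℝ)) ≠ 1) :
    waveletHat q t ω = waveletHat q 0 ω * phase (t * (SignType.sign ω : ℝ)) := by
  have hsign : SignType.sign (ω / 2) = SignType.sign ω := by
    rw [div_eq_mul_inv, sign_mul, sign_pos (inv_pos.2 (two_pos : (0 : ℝ) < 2)), mul_one]
  have hphase : phase (t * (SignType.sign ω : ℝ)) =
      exp (2 * I * t * (1 - exp (I * ((ω / 2 : ℝ) : ℂ))).arg) *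
        exp (2 * I * t *
          ((1 - exp (-(I * ((ω / 2 : ℝ) : ℂ)))) / (I * (ω / 2 : ℝ))).arg) := by
    have h := congrArg (fun x : ℝ => (x : ℂ)) (arg_one_sub_exp_add hω).1
    simp only [ofReal_add] at h
    rw [← exp_add, ← mul_add, h, hsign, phase]
    congr 1
    push_cast
    ring
  unfold waveletHat waveletFilter
  rw [refinementFilter_eq_mul_exp α t hω, splineHat_eq_mul_exp α t hω, hphase]
  ring

theorem ae_exp_ne_one {c : ℝ} (hc : c ≠ 0) : ∀ᵐ ξ : ℝ, exp (I * (c * ξ : ℝ)) ≠ 1 := by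
  have hcount : (Set.range fun n : ℤ => (2 * Real.pi * n) / c).Countable :=
    Set.countable_range _
  filter_upwards [hcount.ae_notMem volume] with ξ hξ h
  obtain ⟨n, hn⟩ := exp_eq_one_iff.1 h
  refine hξ ⟨n, ?_⟩
  have h' : ((c * ξ : ℝ) : ℂ) = ((2 * Real.pi * n : ℝ) : ℂ) := by
    have : I * ((c * ξ : ℝ) : ℂ) = I * ((2 * Real.pi * n : ℝ) : ℂ) := by
      rw [hn]
      push_cast
      ring
    exact mul_left_cancel₀ I_ne_zero this
  have h'' : c * ξ = 2 * Real.pi * n := ofReal_injective h'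
  simp only
  rw [← h'']
  field_simp

/-! ### Tensor products and the Fourier transform -/

/-- The Fourier integral computes the `L²` Fourier transform of an integrable function. -/
theorem fourier_eq_of_ae_eq_fourierIntegral {V : Type*} [NormedAddCommGroup V]
    [InnerProductSpace ℝ V] [FiniteDimensional ℝ V] [MeasurableSpace V] [BorelSpace V]
    {f g : Lp ℂ 2 (volume : Measure V)} {F : V → ℂ} (hF : Integrable F) (hf : f =ᵐ[volume] F)
    (hg : g =ᵐ[volume] 𝓕 F) : 𝓕 f = g := by
  -- An `L²` class is determined by its tempered distribution, so the claim reduces to moving the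
  -- Fourier integral from `F` onto a Schwartz function.
  have hinj : Function.Injective (Lp.toTemperedDistributionCLM (E := V) ℂ volume 2) :=
    LinearMap.ker_eq_bot.1 Lp.ker_toTemperedDistributionCLM_eq_bot
  apply hinj
  rw [Lp.toTemperedDistributionCLM_apply, Lp.toTemperedDistributionCLM_apply,
    ← Lp.fourier_toTemperedDistribution_eq]
  ext φ
  rw [TemperedDistribution.fourier_apply, Lp.toTemperedDistribution_apply,
    Lp.toTemperedDistribution_apply]
  have h1 : ∫ x, (𝓕 φ) x • f x = ∫ x, (𝓕 (φ : V → ℂ)) x • F x := by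
    refine integral_congr_ae ?_
    filter_upwards [hf] with x hx
    rw [hx, SchwartzMap.fourier_coe]
  have h2 : ∫ x, φ x • g x = ∫ x, φ x • (𝓕 F) x := by
    refine integral_congr_ae ?_
    filter_upwards [hg] with x hx
    rw [hx]
  rw [h1, h2]
  simpa using! VectorFourier.integral_fourierIntegral_smul_eq_flip (L := innerₗ V)
    Real.continuous_fourierChar continuous_inner φ.integrable hF

/-- The plane as a product of two lines. -/
noncomputable def planeEquiv : Plane ≃ᵐ ℝ × ℝ :=
  (MeasurableEquiv.toLp 2 (Fin 2 → ℝ)).symm.trans MeasurableEquiv.finTwoArrow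

theorem measurePreserving_planeEquiv : MeasurePreserving planeEquiv
    (volume : Measure Plane) ((volume : Measure ℝ).prod (volume : Measure ℝ)) :=
  (volume_preserving_finTwoArrow ℝ).comp (PiLp.volume_preserving_ofLp (Fin 2))

/-- Stated over `RCLike` to serve both the real integrals of squared norms and the complex Fourier
integrals. -/
theorem integral_plane_mul {𝕜 : Type*} [RCLike 𝕜] (f g : ℝ → 𝕜) :
    ∫ x : Plane, f (x 0) * g (x 1) = (∫ x, f x) * ∫ y, g y := by
  rw [← integral_prod_mul f g, ← measurePreserving_planeEquiv.integral_comp']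
  rfl

theorem integrable_plane_mul {f g : ℝ → ℂ} (hf : Integrable f) (hg : Integrable g) :
    Integrable fun x : Plane => f (x 0) * g (x 1) :=
  measurePreserving_planeEquiv.integrable_comp_of_integrable (hf.mul_prod hg)

/-- A projection does not preserve measure, but preimages of null sets are null, which is enough to
lift almost-everywhere statements to the plane. -/
theorem quasiMeasurePreserving_coord (i : Fin 2) :
    Measure.QuasiMeasurePreserving (fun x : Plane => x i) volume volume := by
  fin_cases i
  · exact Measure.quasiMeasurePreserving_fst.comp
      measurePreserving_planeEquiv.quasiMeasurePreserving
  · exact Measure.quasiMeasurePreserving_snd.comp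
      measurePreserving_planeEquiv.quasiMeasurePreserving

theorem ae_coord {p : ℝ → Prop} (hp : ∀ᵐ ξ, p ξ) (i : Fin 2) : ∀ᵐ x : Plane, p (x i) :=
  (quasiMeasurePreserving_coord i).ae hp

theorem coeFn_tensor (f g : L2Line) :
    tensor f g =ᵐ[volume] fun x : Plane => f (x 0) * g (x 1) :=
  (memLp_tensor f g).coeFn_toLp

theorem coeFn_tensor_of_ae_eq {f g : L2Line} {F G : ℝ → ℂ} (hf : f =ᵐ[volume] F)
    (hg : g =ᵐ[volume] G) : tensor f g =ᵐ[volume] fun x : Plane => F (x 0) * G (x 1) := by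
  filter_upwards [coeFn_tensor f g, ae_coord hf 0, ae_coord hg 1] with x h h0 h1
  rw [h, h0, h1]

theorem norm_sq_eq_integral {X : Type*} [MeasurableSpace X] {μ : Measure X} (f : Lp ℂ 2 μ) :
    ‖f‖ ^ 2 = ∫ x, ‖f x‖ ^ 2 ∂μ := by
  have h := L2.inner_def (𝕜 := ℂ) f f
  rw [inner_self_eq_norm_sq_to_K] at h
  simp only [inner_self_eq_norm_sq_to_K] at h
  have h' : ((‖f‖ ^ 2 : ℝ) : ℂ) = ((∫ x, ‖f x‖ ^ 2 ∂μ : ℝ) : ℂ) := by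
    rw [← integral_complex_ofReal]
    simpa using h
  exact ofReal_injective h'

/-- Gives the continuity of `tensor` needed for the density argument in `fourier_tensor`. -/
theorem norm_tensor (f g : L2Line) : ‖tensor f g‖ = ‖f‖ * ‖g‖ := by
  have h : ‖tensor f g‖ ^ 2 = (‖f‖ * ‖g‖) ^ 2 := by
    rw [mul_pow, norm_sq_eq_integral, norm_sq_eq_integral, norm_sq_eq_integral,
      ← integral_plane_mul]
    refine integral_congr_ae ?_
    filter_upwards [coeFn_tensor f g] with x hx
    rw [hx, norm_mul, mul_pow]
  exact (pow_left_inj₀ (norm_nonneg _) (by positivity) two_ne_zero).1 h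

/-- The tensor product as a continuous bilinear map. -/
noncomputable def tensorCLM : L2Line →L[ℂ] L2Line →L[ℂ] L2Plane :=
  LinearMap.mkContinuous₂
    (LinearMap.mk₂ ℂ tensor
      (fun f f' g => Lp.ext <| by
        filter_upwards [coeFn_tensor (f + f') g, coeFn_tensor f g, coeFn_tensor f' g,
          Lp.coeFn_add (tensor f g) (tensor f' g), ae_coord (Lp.coeFn_add f f') 0]
          with x h1 h2 h3 h4 h5
        rw [h1, h4, Pi.add_apply, h2, h3, h5, Pi.add_apply, add_mul])
      (fun c f g => Lp.ext <| by
        filter_upwards [coeFn_tensor (c • f) g, coeFn_tensor f g,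
          Lp.coeFn_smul c (tensor f g), ae_coord (Lp.coeFn_smul c f) 0] with x h1 h2 h3 h4
        rw [h1, h3, Pi.smul_apply, h2, h4, Pi.smul_apply, smul_mul_assoc])
      (fun f g g' => Lp.ext <| by
        filter_upwards [coeFn_tensor f (g + g'), coeFn_tensor f g, coeFn_tensor f g',
          Lp.coeFn_add (tensor f g) (tensor f g'), ae_coord (Lp.coeFn_add g g') 1]
          with x h1 h2 h3 h4 h5
        rw [h1, h4, Pi.add_apply, h2, h3, h5, Pi.add_apply, mul_add])
      (fun c f g => Lp.ext <| by
        filter_upwards [coeFn_tensor f (c • g), coeFn_tensor f g,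
          Lp.coeFn_smul c (tensor f g), ae_coord (Lp.coeFn_smul c g) 1] with x h1 h2 h3 h4
        rw [h1, h3, Pi.smul_apply, h2, h4, Pi.smul_apply, mul_smul_comm]))
    1 fun f g => by rw [one_mul, LinearMap.mk₂_apply, norm_tensor]

theorem fourierIntegral_plane_mul (f g : ℝ → ℂ) (ω : Plane) :
    𝓕 (fun x : Plane => f (x 0) * g (x 1)) ω = 𝓕 f (ω 0) * 𝓕 g (ω 1) := by
  rw [Real.fourier_eq, Real.fourier_eq, Real.fourier_eq,
    ← integral_plane_mul]
  congr 1
  funext x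
  rw [PiLp.inner_apply, Fin.sum_univ_two, neg_add, Real.fourierChar.map_add_eq_mul, mul_smul]
  simp only [Circle.smul_def, smul_eq_mul]
  ring

theorem fourier_tensor_schwartz (f g : 𝓢(ℝ, ℂ)) :
    𝓕 (tensor (f.toLp 2) (g.toLp 2)) = tensor (𝓕 (f.toLp 2)) (𝓕 (g.toLp 2)) := by
  refine fourier_eq_of_ae_eq_fourierIntegral (integrable_plane_mul f.integrable g.integrable)
    (coeFn_tensor_of_ae_eq (f.coeFn_toLp 2) (g.coeFn_toLp 2)) ?_
  rw [SchwartzMap.toLp_fourier_eq, SchwartzMap.toLp_fourier_eq]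
  have hf : (𝓕 f).toLp 2 =ᵐ[volume] (𝓕 f : 𝓢(ℝ, ℂ)) := SchwartzMap.coeFn_toLp _ 2 volume
  have hg : (𝓕 g).toLp 2 =ᵐ[volume] (𝓕 g : 𝓢(ℝ, ℂ)) := SchwartzMap.coeFn_toLp _ 2 volume
  filter_upwards [coeFn_tensor_of_ae_eq hf hg] with ω hω
  rw [hω, fourierIntegral_plane_mul, SchwartzMap.fourier_coe, SchwartzMap.fourier_coe]

/-- The Fourier transform of a tensor product is the tensor product of the Fourier transforms. -/
theorem fourier_tensor (f g : L2Line) : 𝓕 (tensor f g) = tensor (𝓕 f) (𝓕 g) := by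
  have hF : Continuous fun f : L2Line => 𝓕 f := FourierTransform.continuous_fourier
  have hF2 : Continuous fun f : L2Plane => 𝓕 f := FourierTransform.continuous_fourier
  have hT : Continuous fun p : L2Line × L2Line => tensor p.1 p.2 := by
    exact tensorCLM.continuous₂
  have hd : DenseRange (SchwartzMap.toLpCLM ℂ (E := ℝ) ℂ 2 volume) :=
    SchwartzMap.denseRange_toLpCLM ENNReal.ofNat_ne_top
  -- Both sides are continuous in the pair, so pairs of Schwartz functions suffice.
  refine (hd.prodMap hd).induction_on
    (p := fun p : L2Line × L2Line => 𝓕 (tensor p.1 p.2) = tensor (𝓕 p.1) (𝓕 p.2)) (f, g)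
    (isClosed_eq (hF2.comp hT) (hT.comp ((hF.comp continuous_fst).prodMk
      (hF.comp continuous_snd)))) ?_
  rintro ⟨a, b⟩
  exact fourier_tensor_schwartz a b

/-! ### Fourier transforms of the spline and the wavelet -/

theorem fourier_spline_ae (α : ℝ≥0) (t : ℝ) :
    (𝓕 (spline α t) : L2Line) =ᵐ[volume] fun ξ => splineHat α t (2 * Real.pi * ξ) := by
  rw [spline, FourierTransform.fourier_fourierInv_eq]
  exact MemLp.coeFn_toLp _

theorem fourier_wavelet_ae {α : ℝ≥0} (q : Genus α) (t : ℝ) :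
    (𝓕 (wavelet q t) : L2Line) =ᵐ[volume] fun ξ => waveletHat q 0 (2 * Real.pi * ξ) *
      phase (t * (SignType.sign ξ : ℝ)) := by
  have h : (𝓕 (wavelet q t) : L2Line) =ᵐ[volume] fun ξ => waveletHat q t (2 * Real.pi * ξ) := by
    rw [wavelet, FourierTransform.fourier_fourierInv_eq]
    exact MemLp.coeFn_toLp _
  -- Filter and spline are evaluated at half of `ω = 2πξ`, hence the constant `π`; the excluded `ξ`
  -- are the even integers.
  filter_upwards [h, ae_exp_ne_one Real.pi_ne_zero] with ξ hξ hne
  rw [hξ, waveletHat_eq_mul_phase, sign_mul, sign_pos Real.two_pi_pos, one_mul]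
  rwa [show 2 * Real.pi * ξ / 2 = Real.pi * ξ by ring]

/-! ### The fractional Hilbert transform of a dual-tree wavelet -/

/-- The frequency response of the fractional directional Hilbert transform. -/
noncomputable def fdHTMultiplier (θ t : ℝ) (ω : Plane) : ℂ :=
  Real.cos (Real.pi * t) - Real.sin (Real.pi * t) * dirMultiplier θ ω

theorem fourier_L2_sub (f g : L2Plane) : 𝓕 (f - g) = 𝓕 f - 𝓕 g :=
  map_sub (Lp.fourierTransformₗᵢ Plane ℂ) f g

theorem fourier_fdHT_ae (θ t : ℝ) (f : L2Plane) :
    (𝓕 (fdHT θ t f) : L2Plane) =ᵐ[volume]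
      fun ω => fdHTMultiplier θ t ω * (𝓕 f : L2Plane) ω := by
  have h : 𝓕 (fdHT θ t f) = (Real.cos (Real.pi * t) : ℂ) • (𝓕 f : L2Plane) -
      (Real.sin (Real.pi * t) : ℂ) • (memLp_dirMultiplier_mul θ (𝓕 f)).toLp := by
    rw [fdHT, fourier_L2_sub, FourierTransform.fourier_smul,
      FourierTransform.fourier_smul, dirHilbert, FourierTransform.fourier_fourierInv_eq]
  rw [h]
  filter_upwards [Lp.coeFn_sub ((Real.cos (Real.pi * t) : ℂ) • (𝓕 f : L2Plane))
      ((Real.sin (Real.pi * t) : ℂ) • (memLp_dirMultiplier_mul θ (𝓕 f)).toLp),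
    Lp.coeFn_smul (Real.cos (Real.pi * t) : ℂ) (𝓕 f : L2Plane),
    Lp.coeFn_smul (Real.sin (Real.pi * t) : ℂ) (memLp_dirMultiplier_mul θ (𝓕 f)).toLp,
    (memLp_dirMultiplier_mul θ (𝓕 f)).coeFn_toLp] with ω h1 h2 h3 h4
  rw [h1, Pi.sub_apply, h2, h3, Pi.smul_apply, Pi.smul_apply, h4, fdHTMultiplier, smul_eq_mul,
    smul_eq_mul]
  ring

theorem phase_eq_cos_sub_sin (t : ℝ) :
    phase t = Real.cos (Real.pi * t) - Real.sin (Real.pi * t) * I := by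
  rw [phase, ← neg_mul, exp_mul_I, cos_neg, sin_neg]
  push_cast
  ring

theorem fdHTMultiplier_of_pos {θ : ℝ} {ω : Plane} (t : ℝ) (h : 0 < inner ℝ (unitVec θ) ω) :
    fdHTMultiplier θ t ω = phase (-t) := by
  rw [fdHTMultiplier, dirMultiplier, sign_pos h, phase_eq_cos_sub_sin]
  simp

theorem fdHTMultiplier_of_neg {θ : ℝ} {ω : Plane} (t : ℝ) (h : inner ℝ (unitVec θ) ω < 0) :
    fdHTMultiplier θ t ω = phase t := by
  rw [fdHTMultiplier, dirMultiplier, sign_neg h, phase_eq_cos_sub_sin]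
  simp

theorem inner_unitVec (θ : ℝ) (ω : Plane) :
    inner ℝ (unitVec θ) ω = Real.cos θ * ω 0 + Real.sin θ * ω 1 := by
  rw [PiLp.inner_apply, Fin.sum_univ_two]
  simp [unitVec, mul_comm]

/-- The Fourier transform of `ψ_ℓ(·; α, (a, b))`. -/
noncomputable def dualTreeHat {α : ℝ≥0} (q : Genus α) (l : Fin 6) (a b : ℝ) (ω : Plane) : ℂ :=
  ![waveletHat q 0 (2 * Real.pi * ω 0) * phase (a * (SignType.sign (ω 0) : ℝ)) *
      splineHat α (b) (2 * Real.pi * ω 1),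
    waveletHat q 0 (2 * Real.pi * ω 0) * phase (a * (SignType.sign (ω 0) : ℝ)) *
      splineHat α (b + 1 / 2) (2 * Real.pi * ω 1),
    splineHat α (a) (2 * Real.pi * ω 0) *
      (waveletHat q 0 (2 * Real.pi * ω 1) * phase (b * (SignType.sign (ω 1) : ℝ))),
    splineHat α (a + 1 / 2) (2 * Real.pi * ω 0) *
      (waveletHat q 0 (2 * Real.pi * ω 1) * phase (b * (SignType.sign (ω 1) : ℝ))),
    ((1 / Real.sqrt 2 : ℝ) : ℂ) * (
      waveletHat q 0 (2 * Real.pi * ω 0) * phase (a * (SignType.sign (ω 0) : ℝ)) *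
        (waveletHat q 0 (2 * Real.pi * ω 1) * phase (b * (SignType.sign (ω 1) : ℝ))) -
      waveletHat q 0 (2 * Real.pi * ω 0) * phase ((a + 1 / 2) * (SignType.sign (ω 0) : ℝ)) *
        (waveletHat q 0 (2 * Real.pi * ω 1) *
          phase ((b + 1 / 2) * (SignType.sign (ω 1) : ℝ)))),
    ((1 / Real.sqrt 2 : ℝ) : ℂ) * (
      waveletHat q 0 (2 * Real.pi * ω 0) * phase (a * (SignType.sign (ω 0) : ℝ)) *
        (waveletHat q 0 (2 * Real.pi * ω 1) * phase (b * (SignType.sign (ω 1) : ℝ))) +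
      waveletHat q 0 (2 * Real.pi * ω 0) * phase ((a + 1 / 2) * (SignType.sign (ω 0) : ℝ)) *
        (waveletHat q 0 (2 * Real.pi * ω 1) *
          phase ((b + 1 / 2) * (SignType.sign (ω 1) : ℝ))))] l

theorem coeFn_fourier_tensor_of_ae_eq {f g : L2Line} {F G : ℝ → ℂ}
    (hf : (𝓕 f : L2Line) =ᵐ[volume] F) (hg : (𝓕 g : L2Line) =ᵐ[volume] G) :
    (𝓕 (tensor f g) : L2Plane) =ᵐ[volume] fun ω : Plane => F (ω 0) * G (ω 1) := by
  rw [fourier_tensor]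
  exact coeFn_tensor_of_ae_eq hf hg

theorem fourier_dualTreeWavelet_ae {α : ℝ≥0} (q : Genus α) (l : Fin 6) (τ : Plane) :
    (𝓕 (dualTreeWavelet q l τ) : L2Plane) =ᵐ[volume] dualTreeHat q l (τ 0) (τ 1) := by
  have hψψ (s t : ℝ) :=
    coeFn_fourier_tensor_of_ae_eq (fourier_wavelet_ae q s) (fourier_wavelet_ae q t)
  fin_cases l
  · exact coeFn_fourier_tensor_of_ae_eq (fourier_wavelet_ae q _) (fourier_spline_ae α _)
  · exact coeFn_fourier_tensor_of_ae_eq (fourier_wavelet_ae q _) (fourier_spline_ae α _)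
  · exact coeFn_fourier_tensor_of_ae_eq (fourier_spline_ae α _) (fourier_wavelet_ae q _)
  · exact coeFn_fourier_tensor_of_ae_eq (fourier_spline_ae α _) (fourier_wavelet_ae q _)
  · change (𝓕 (((1 / Real.sqrt 2 : ℝ) : ℂ) • (tensor (wavelet q (τ 0)) (wavelet q (τ 1)) -
      tensor (wavelet q (τ 0 + 1 / 2)) (wavelet q (τ 1 + 1 / 2)))) : L2Plane) =ᵐ[volume] _
    rw [FourierTransform.fourier_smul, fourier_L2_sub]
    refine (Lp.coeFn_smul _ _).trans ?_
    filter_upwards [Lp.coeFn_sub (𝓕 (tensor (wavelet q (τ 0)) (wavelet q (τ 1))) : L2Plane)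
      (𝓕 (tensor (wavelet q (τ 0 + 1 / 2)) (wavelet q (τ 1 + 1 / 2))) : L2Plane),
      hψψ (τ 0) (τ 1), hψψ (τ 0 + 1 / 2) (τ 1 + 1 / 2)] with ω h1 h2 h3
    rw [Pi.smul_apply, h1, Pi.sub_apply, h2, h3]
    rfl
  · change (𝓕 (((1 / Real.sqrt 2 : ℝ) : ℂ) • (tensor (wavelet q (τ 0)) (wavelet q (τ 1)) +
      tensor (wavelet q (τ 0 + 1 / 2)) (wavelet q (τ 1 + 1 / 2)))) : L2Plane) =ᵐ[volume] _
    rw [FourierTransform.fourier_smul, FourierTransform.fourier_add]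
    refine (Lp.coeFn_smul _ _).trans ?_
    filter_upwards [Lp.coeFn_add (𝓕 (tensor (wavelet q (τ 0)) (wavelet q (τ 1))) : L2Plane)
      (𝓕 (tensor (wavelet q (τ 0 + 1 / 2)) (wavelet q (τ 1 + 1 / 2))) : L2Plane),
      hψψ (τ 0) (τ 1), hψψ (τ 0 + 1 / 2) (τ 1 + 1 / 2)] with ω h1 h2 h3
    rw [Pi.smul_apply, h1, Pi.add_apply, h2, h3]
    rfl

/-! ### Phase identities and comparison by quadrant -/

theorem phase_neg (t : ℝ) : phase (-t) = (phase t)⁻¹ := by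
  rw [phase, phase, ← exp_neg]
  simp

theorem phase_ne_zero (t : ℝ) : phase t ≠ 0 := exp_ne_zero _

theorem phase_sub (s t : ℝ) : phase (s - t) = phase s * (phase t)⁻¹ := by
  rw [sub_eq_add_neg, phase_add, phase_neg]

/-- For the diagonal orientations each coordinate carries half of the shift. -/
theorem phase_eq_half_sq (t : ℝ) : phase t = phase (t / 2) * phase (t / 2) := by
  rw [← phase_add, add_halves]

theorem phase_half_sq : phase (1 / 2) ^ 2 = -1 := by
  rw [sq, ← phase_add, add_halves, phase_one]

/-- Handles the axis orientations, where `x` is the frequency coordinate of the wavelet factor. -/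
theorem fdHTMultiplier_mul_phase {θ x : ℝ} {ω : Plane} (hx : x ≠ 0)
    (h : inner ℝ (unitVec θ) ω = x) (a t : ℝ) :
    fdHTMultiplier θ t ω * phase (a * (SignType.sign x : ℝ)) =
      phase ((a - t) * (SignType.sign x : ℝ)) := by
  rcases hx.lt_or_gt with h0 | h0
  · rw [fdHTMultiplier_of_neg t (h ▸ h0), sign_neg h0, ← phase_add]
    congr 1
    simp [sub_eq_add_neg]
  · rw [fdHTMultiplier_of_pos t (h ▸ h0), sign_pos h0, ← phase_add]
    congr 1
    simp [sub_eq_add_neg, add_comm]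

theorem mul_inv_sqrt_two_mul (t : ℝ) : t * (1 / √2) * (√2 / 2) = t / 2 := by
  have h : √2 ≠ 0 := by positivity
  field_simp

/-- The frequency response of the fractional directional Hilbert transform shifts the wavelets. -/
theorem fdHTMultiplier_mul_dualTreeHat {α : ℝ≥0} (q : Genus α) (l : Fin 6) (a b t : ℝ)
    {ω : Plane} (h0 : ω 0 ≠ 0) (h1 : ω 1 ≠ 0) :
    fdHTMultiplier (orientation l) t ω * dualTreeHat q l a b ω =
      dualTreeHat q l (a - t * shiftFactor l * Real.cos (orientation l))
        (b - t * shiftFactor l * Real.sin (orientation l)) ω := by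
  have hs : 0 < √2 / 2 := by positivity
  have hcos : Real.cos (3 * Real.pi / 4) = -(√2 / 2) := by
    rw [show 3 * Real.pi / 4 = Real.pi - Real.pi / 4 by ring, Real.cos_pi_sub,
      Real.cos_pi_div_four]
  have hsin : Real.sin (3 * Real.pi / 4) = √2 / 2 := by
    rw [show 3 * Real.pi / 4 = Real.pi - Real.pi / 4 by ring, Real.sin_pi_sub,
      Real.sin_pi_div_four]
  have hzero := fdHTMultiplier_mul_phase (θ := 0) (ω := ω) h0 (by simp [inner_unitVec]) a t
  have htwo := fdHTMultiplier_mul_phase (θ := Real.pi / 2) (ω := ω) h1 (by simp [inner_unitVec]) b t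
  have ht := phase_eq_half_sq t
  -- Cancellation of the two branches: `hi` when the frequency signs differ (`ψ_5`), `hh` and `hh'`
  -- when both are positive or both negative (`ψ_6`).
  have hi := inv_mul_cancel₀ (phase_ne_zero (1 / 2))
  have hh : phase (1 / 2) ^ 2 = -1 := phase_half_sq
  have hh' : (phase (1 / 2))⁻¹ ^ 2 = -1 := by rw [inv_pow, hh]; norm_num
  set v := waveletHat q 0 (2 * Real.pi * ω 0) with hv
  set w := waveletHat q 0 (2 * Real.pi * ω 1) with hw
  set c := ((1 / √2 : ℝ) : ℂ) with hc
  fin_cases l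
  · change fdHTMultiplier 0 t ω * dualTreeHat q 0 a b ω =
      dualTreeHat q 0 (a - t * 1 * Real.cos 0) (b - t * 1 * Real.sin 0) ω
    simp only [dualTreeHat, Matrix.cons_val, Real.cos_zero, Real.sin_zero, mul_one, mul_zero,
      sub_zero]
    linear_combination v * splineHat α b (2 * Real.pi * ω 1) * hzero
  · change fdHTMultiplier 0 t ω * dualTreeHat q 1 a b ω =
      dualTreeHat q 1 (a - t * 1 * Real.cos 0) (b - t * 1 * Real.sin 0) ω
    simp only [dualTreeHat, Matrix.cons_val, Real.cos_zero, Real.sin_zero, mul_one, mul_zero,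
      sub_zero]
    linear_combination v * splineHat α (b + 1 / 2) (2 * Real.pi * ω 1) * hzero
  · change fdHTMultiplier (Real.pi / 2) t ω * dualTreeHat q 2 a b ω =
      dualTreeHat q 2 (a - t * 1 * Real.cos (Real.pi / 2))
        (b - t * 1 * Real.sin (Real.pi / 2)) ω
    simp only [dualTreeHat, Matrix.cons_val, Real.cos_pi_div_two, Real.sin_pi_div_two, mul_one,
      mul_zero, sub_zero]
    linear_combination splineHat α a (2 * Real.pi * ω 0) * w * htwo
  · change fdHTMultiplier (Real.pi / 2) t ω * dualTreeHat q 3 a b ω =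
      dualTreeHat q 3 (a - t * 1 * Real.cos (Real.pi / 2))
        (b - t * 1 * Real.sin (Real.pi / 2)) ω
    simp only [dualTreeHat, Matrix.cons_val, Real.cos_pi_div_two, Real.sin_pi_div_two, mul_one,
      mul_zero, sub_zero]
    linear_combination splineHat α (a + 1 / 2) (2 * Real.pi * ω 0) * w * htwo
  · change fdHTMultiplier (Real.pi / 4) t ω * dualTreeHat q 4 a b ω =
      dualTreeHat q 4 (a - t * (1 / √2) * Real.cos (Real.pi / 4))
        (b - t * (1 / √2) * Real.sin (Real.pi / 4)) ω
    have hin := inner_unitVec (Real.pi / 4) ω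
    rw [Real.cos_pi_div_four, Real.sin_pi_div_four] at hin
    simp only [dualTreeHat, Matrix.cons_val, Real.cos_pi_div_four, Real.sin_pi_div_four,
      mul_inv_sqrt_two_mul]
    rw [← hv, ← hw, ← hc]
    clear_value v w c
    set m := fdHTMultiplier (Real.pi / 4) t ω with hm
    set p := phase (t / 2)
    -- Where the signs agree, the multiplier is `p^{∓2}`, matching the two half-shifts; where they
    -- differ, both sides vanish.
    rcases h0.lt_or_gt with h | h <;> rcases h1.lt_or_gt with h' | h' <;>
      simp only [h, h', sign_pos, sign_neg, SignType.coe_neg_one, SignType.coe_one, mul_one,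
        mul_neg_one, phase_neg, phase_sub, phase_add, mul_inv, inv_inv]
    · rw [hm, fdHTMultiplier_of_neg t (by nlinarith), ht]
      ring
    · linear_combination (p * p⁻¹ - m) * c * v * w * (phase a)⁻¹ * phase b * hi
    · linear_combination (p * p⁻¹ - m) * c * v * w * phase a * (phase b)⁻¹ * hi
    · rw [hm, fdHTMultiplier_of_pos t (by rw [hin]; positivity), phase_neg, ht]
      ring
  · change fdHTMultiplier (3 * Real.pi / 4) t ω * dualTreeHat q 5 a b ω =
      dualTreeHat q 5 (a - t * (1 / √2) * Real.cos (3 * Real.pi / 4))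
        (b - t * (1 / √2) * Real.sin (3 * Real.pi / 4)) ω
    have hin := inner_unitVec (3 * Real.pi / 4) ω
    rw [hcos, hsin] at hin
    simp only [dualTreeHat, Matrix.cons_val, hcos, hsin, mul_neg, mul_inv_sqrt_two_mul,
      sub_neg_eq_add]
    rw [← hv, ← hw, ← hc]
    clear_value v w c
    set m := fdHTMultiplier (3 * Real.pi / 4) t ω with hm
    set p := phase (t / 2)
    -- The roles of the quadrants are exchanged: both sides vanish where the signs agree.
    rcases h0.lt_or_gt with h | h <;> rcases h1.lt_or_gt with h' | h' <;>
      simp only [h, h', sign_pos, sign_neg, SignType.coe_neg_one, SignType.coe_one, mul_one,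
        mul_neg_one, phase_neg, phase_sub, phase_add, mul_inv, inv_inv]
    · linear_combination (m - p * p⁻¹) * c * v * w * (phase a)⁻¹ * (phase b)⁻¹ * hh'
    · rw [hm, fdHTMultiplier_of_pos t (by nlinarith), phase_neg, ht]
      ring
    · rw [hm, fdHTMultiplier_of_neg t (by nlinarith), ht]
      ring
    · linear_combination (m - p * p⁻¹) * c * v * w * phase a * phase b * hh

end DualTreeSpline

theorem mainTheorem6 (α : NNReal) (q : DualTreeSpline.Genus α) (l : Fin 6)
    (τ : DualTreeSpline.Plane) (τbar : ℝ) :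
    DualTreeSpline.fdHT (DualTreeSpline.orientation l) τbar
        (DualTreeSpline.dualTreeWavelet q l τ) =
      DualTreeSpline.dualTreeWavelet q l
        (τ - (τbar * DualTreeSpline.shiftFactor l) •
          DualTreeSpline.unitVec (DualTreeSpline.orientation l)) := by
  open DualTreeSpline MeasureTheory in
  -- By Plancherel it suffices to compare transforms, almost everywhere and hence off the two
  -- coordinate axes.
  apply (Lp.fourierTransformₗᵢ Plane ℂ).injective
  change 𝓕 (fdHT _ _ _) = 𝓕 (dualTreeWavelet _ _ _)
  apply Lp.ext
  filter_upwards [fourier_fdHT_ae (orientation l) τbar (dualTreeWavelet q l τ),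
    fourier_dualTreeWavelet_ae q l τ,
    fourier_dualTreeWavelet_ae q l
      (τ - (τbar * shiftFactor l) • unitVec (orientation l)),
    ae_coord (Measure.ae_ne volume 0) 0, ae_coord (Measure.ae_ne volume 0) 1]
    with ω h1 h2 h3 h4 h5
  rw [h1, h2, h3]
  exact fdHTMultiplier_mul_dualTreeHat q l (τ 0) (τ 1) τbar h4 h5
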